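/- For a finite set $S\subset\mathbb R^3$ with at least two points, let its \emph{spread} $\Delta(S)$ be the ratio between the longest and the shortest distance between two distinct points of $S$. Two distinct points of $S$ are \emph{Delaunay neighbors} (joined by a Delaunay edge) if they lie on a common sphere with no point of $S$ in its interior. A \emph{Delaunay triangulation} of $S$ is a geometric simplicial complex whose vertex set is $S$, whose underlying space is the convex hull of $S$, and each of whose simplices has all its vertices on some sphere with no point of $S$ in its interior; its \emph{complexity} is its total number of simplices of all dimensions. There is an absolute constant $C$ such that for every finite set $S\subset\mathbb R^3$ with at least two points, the number of Delaunay edges of $S$ is at most $C\,\Delta(S)^4$, and every Delaunay triangulation of $S$ has complexity at most $C\,\Delta(S)^4$. -/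

import Mathlib

/-- Euclidean three-space. -/
abbrev E3 : Type := EuclideanSpace ℝ (Fin 3)

/-- The spread of a point set: the ratio between its longest and its shortest pairwise distance
(meaningful for finite sets with at least two points). -/
noncomputable def spread (S : Finset E3) : ℝ :=
  Metric.diam (S : Set E3) / Set.infsep (S : Set E3)

/-- All points of `F` lie on a common sphere that has no point of `S` in its interior. -/
def OnEmptySphere (S : Finset E3) (F : Set E3) : Prop :=
  ∃ (c : E3) (ρ : ℝ), (∀ v ∈ F, dist v c = ρ) ∧ ∀ p ∈ S, ρ ≤ dist p c

/-- The Delaunay graph of `S`: two distinct points of `S` are joined by an edge if and only if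
they lie on a sphere with no points of `S` in its interior. -/
def delaunayGraph (S : Finset E3) : SimpleGraph E3 where
  Adj p q := p ≠ q ∧ p ∈ S ∧ q ∈ S ∧ OnEmptySphere S {p, q}
  symm := ⟨fun p q h => ⟨h.1.symm, h.2.2.1, h.2.1, by rw [Set.pair_comm]; exact h.2.2.2⟩⟩
  loopless := ⟨fun _ h => h.1 rfl⟩

/-- A simplicial complex `K` is a Delaunay triangulation of `S` if its vertices are exactly the
points of `S`, it covers the convex hull of `S`, and the vertices of each of its simplices lie on
a sphere with no points of `S` in its interior. -/
structure IsDelaunayTriangulation (S : Finset E3) (K : Geometry.SimplicialComplex ℝ E3) :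
    Prop where
  vertices_eq : K.vertices = (S : Set E3)
  space_eq : K.space = convexHull ℝ (S : Set E3)
  empty_sphere : ∀ F ∈ K.faces, OnEmptySphere S (F : Set E3)

/-- The complexity of a triangulation: its total number of simplices of all dimensions (a finite
number when there are finitely many vertices). -/
noncomputable def complexity (K : Geometry.SimplicialComplex ℝ E3) : ℕ :=
  K.faces.ncard

/-! Let `m` and `D` be the least and greatest distances in `S`. Both endpoints of a Delaunay edge of
length at least `l` lie on an empty ball of diameter at least `l`. Sort such points by the signed
axis along which the centre of the ball is farthest off: within one of the six classes, a box with
side `l/4` along the axis and `m/16` across it holds at most one point. Hence a ball of radius `L ≥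
l` contains `O(L³/(m²l))` of them (`card_le_of_empty_balls`). With `L = D` for the first endpoint
and `L = 2l` for the second, there are `O(D³l/m⁴)` edges of length in `[l, 2l]`, and the sum over
dyadic `l` is `O((D/m)⁴)`.

The complexity is bounded by the number of vertices and edges. Every face lies in one whose affine
span contains `S`. If such a spanning face has at least three vertices, take a direction `z`
parallel to no segment between points of `S`. Moving along `z` from the centroid of the vertices
where `z` has nonpositive barycentric coordinate enters the relative interior of the face, so this
vertex set and `z` determine the face (`eq_of_direction`). For `z` or `-z` the set has at most two
elements, so it is a vertex or a Delaunay edge. -/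

/-! ### Packing points that touch large empty balls -/

/-- A vector of length at least `m` that is nearly parallel to the first axis cannot have both
endpoints on or outside a large ball that is entered in that direction. -/
lemma not_outside_ball_of_nearly_parallel {l m ρ d₀ d₁ d₂ w₀ w₁ w₂ : ℝ} (hm : 0 < m) (hml : m ≤ l)
    (hρ : l / 2 ≤ ρ) (hw : w₀ ^ 2 + w₁ ^ 2 + w₂ ^ 2 = ρ ^ 2) (hw₀ : ρ / 2 ≤ w₀)
    (hd₀ : 0 ≤ d₀) (hd₀' : d₀ ≤ l / 4) (hd₁ : |d₁| ≤ m / 16) (hd₂ : |d₂| ≤ m / 16)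
    (hout : ρ ^ 2 ≤ (w₀ - d₀) ^ 2 + (w₁ - d₁) ^ 2 + (w₂ - d₂) ^ 2) :
    d₀ ^ 2 + d₁ ^ 2 + d₂ ^ 2 < m ^ 2 := by
  have hρ0 : 0 < ρ := by linarith
  have h1 : |w₁ * d₁| ≤ ρ * (m / 16) := by
    rw [abs_mul]
    exact mul_le_mul (abs_le_of_sq_le_sq (by nlinarith) hρ0.le) hd₁ (abs_nonneg _) hρ0.le
  have h2 : |w₂ * d₂| ≤ ρ * (m / 16) := by
    rw [abs_mul]
    exact mul_le_mul (abs_le_of_sq_le_sq (by nlinarith) hρ0.le) hd₂ (abs_nonneg _) hρ0.le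
  have h0 : ρ / 2 * d₀ ≤ w₀ * d₀ := mul_le_mul_of_nonneg_right hw₀ hd₀
  have s1 : d₁ ^ 2 ≤ (m / 16) ^ 2 := sq_le_sq' (abs_le.1 hd₁).1 (abs_le.1 hd₁).2
  have s2 : d₂ ^ 2 ≤ (m / 16) ^ 2 := sq_le_sq' (abs_le.1 hd₂).1 (abs_le.1 hd₂).2
  have h1' := (abs_le.1 h1).1
  have h2' := (abs_le.1 h2).1
  -- Being outside the ball means `2 w·d ≤ |d|²`, so `ρ (d₀ - m/4) ≤ d₀² + m²/128`. With `ρ ≥ l/2`,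
  -- `d₀ ≤ l/4` and `m ≤ l`, this gives `d₀/4 ≤ m/8 + m/128`.
  have key : d₀ ≤ 17 / 32 * m := by
    by_contra! hcon
    have e1 : ρ * (d₀ - m / 4) ≤ d₀ ^ 2 + m ^ 2 / 128 := by nlinarith
    have e2 : l / 2 * (d₀ - m / 4) ≤ ρ * (d₀ - m / 4) :=
      mul_le_mul_of_nonneg_right hρ (by linarith)
    have e3 : d₀ ^ 2 ≤ d₀ * (l / 4) := by nlinarith
    have e4 : m ^ 2 ≤ l * m := by nlinarith
    nlinarith
  have : d₀ ^ 2 ≤ (17 / 32 * m) ^ 2 := by gcongr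
  nlinarith

lemma EuclideanSpace.dist_sq_eq_sum {n : Type*} [Fintype n] (x y : EuclideanSpace ℝ n) :
    dist x y ^ 2 = ∑ i, (x i - y i) ^ 2 := by
  rw [EuclideanSpace.dist_eq, Real.sq_sqrt (Finset.sum_nonneg fun _ _ => sq_nonneg _)]
  simp [Real.dist_eq, sq_abs]

lemma Int.abs_sub_le_of_floor_div_eq {a b w : ℝ} (hw : 0 < w) (h : ⌊a / w⌋ = ⌊b / w⌋) :
    |a - b| ≤ w := by
  have := Int.abs_sub_lt_one_of_floor_eq_floor h
  rw [← sub_div, abs_div, abs_of_pos hw, div_lt_one hw] at this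
  exact this.le

lemma Int.card_Icc_floor_le {y : ℝ} (hy : 4 ≤ y) :
    ((Finset.Icc ⌊-y⌋ ⌊y⌋).card : ℝ) ≤ 3 * y := by
  have h : (0 : ℤ) ≤ ⌊y⌋ + 1 - ⌊-y⌋ := by
    have := Int.floor_mono (show -y ≤ y by linarith)
    omega
  have h' : ((Finset.Icc ⌊-y⌋ ⌊y⌋).card : ℝ) = ((⌊y⌋ + 1 - ⌊-y⌋ : ℤ) : ℝ) := by
    rw [Int.card_Icc]
    exact_mod_cast Int.toNat_of_nonneg h
  rw [h']
  push_cast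
  linarith [Int.floor_le y, Int.lt_floor_add_one (-y)]

/-- Packing bound for points touching large empty balls entered in one of six directions. -/
lemma card_le_of_empty_balls_in_direction (T : Finset E3) (x : E3) {m l L σ : ℝ} (j : Fin 3)
    (hσ : σ ^ 2 = 1) (hm : 0 < m) (hml : m ≤ l) (hlL : l ≤ L)
    (sep : ∀ p ∈ T, ∀ q ∈ T, p ≠ q → m ≤ dist p q) (hx : ∀ p ∈ T, dist p x ≤ L)
    (hE : ∀ p ∈ T, ∃ c : E3, ∃ ρ : ℝ, l / 2 ≤ ρ ∧ dist p c = ρ ∧ (∀ q ∈ T, ρ ≤ dist q c) ∧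
      ρ / 2 ≤ σ * (c j - p j)) :
    (T.card : ℝ) ≤ 27648 * (L / m) ^ 2 * (L / l) := by
  have hl : 0 < l := hm.trans_le hml
  have hL : 0 < L := hl.trans_le hlL
  let w : Fin 3 → ℝ := fun i => if i = j then l / 4 else m / 16
  have hw : ∀ i, 0 < w i := fun i => by simp only [w]; split_ifs <;> positivity
  have hwL : ∀ i, 4 ≤ L / w i := fun i => by
    rw [le_div_iff₀ (hw i)]; simp only [w]; split_ifs <;> linarith
  let f : E3 → Fin 3 → ℤ := fun p i => ⌊(p i - x i) / w i⌋
  let B : Finset (Fin 3 → ℤ) := Fintype.piFinset fun i => Finset.Icc ⌊-(L / w i)⌋ ⌊L / w i⌋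
  have maps : ∀ p ∈ T, f p ∈ B := by
    intro p hp
    rw [Fintype.mem_piFinset]
    intro i
    have : |p i - x i| ≤ L := by
      refine abs_le_of_sq_le_sq ?_ hL.le
      calc (p i - x i) ^ 2 ≤ ∑ i, (p i - x i) ^ 2 :=
            Finset.single_le_sum (f := fun i => (p i - x i) ^ 2) (fun _ _ => sq_nonneg _)
              (Finset.mem_univ i)
        _ = dist p x ^ 2 := (EuclideanSpace.dist_sq_eq_sum p x).symm
        _ ≤ L ^ 2 := by gcongr; exact hx p hp
    rw [abs_le] at this
    rw [Finset.mem_Icc, ← neg_div]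
    exact ⟨Int.floor_mono (div_le_div_of_nonneg_right this.1 (hw i).le),
      Int.floor_mono (div_le_div_of_nonneg_right this.2 (hw i).le)⟩
  have close : ∀ p ∈ T, ∀ q ∈ T, 0 ≤ σ * (q j - p j) → (∀ i, |q i - p i| ≤ w i) →
      dist p q < m := by
    intro p hp q hq hs hi
    obtain ⟨c, ρ, hρ, hpc, hemp, hdir⟩ := hE p hp
    have hρ0 : 0 < ρ := by linarith
    have h1 : ∑ i, (p i - c i) ^ 2 = ρ ^ 2 := by rw [← EuclideanSpace.dist_sq_eq_sum, hpc]
    have h2 : ρ ^ 2 ≤ ∑ i, (q i - c i) ^ 2 := by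
      rw [← EuclideanSpace.dist_sq_eq_sum]
      have := hemp q hq
      gcongr
    have hj : σ * (q j - p j) ≤ l / 4 := by
      have := hi j
      simp only [w, if_true] at this
      refine (le_abs_self _).trans ?_
      rwa [abs_mul, (pow_eq_one_iff_of_nonneg (abs_nonneg σ) two_ne_zero).1
        (by rw [sq_abs, hσ]), one_mul]
    refine lt_of_pow_lt_pow_left₀ 2 hm.le ?_
    rw [dist_comm, EuclideanSpace.dist_sq_eq_sum]
    have hσ' : ∀ a : ℝ, (σ * a) ^ 2 = a ^ 2 := fun a => by rw [mul_pow, hσ, one_mul]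
    -- Here `a` and `b` stand for the two axes other than `j`, so that one argument serves all three
    -- cases.
    have main : ∀ a b : Fin 3, a ≠ j → b ≠ j →
        (∀ g : Fin 3 → ℝ, ∑ i, g i = g j + g a + g b) → ∑ i, (q i - p i) ^ 2 < m ^ 2 := by
      intro a b ha hb hsum
      have hia := hi a
      have hib := hi b
      simp only [w, if_neg ha, if_neg hb] at hia hib
      rw [hsum] at h1 h2 ⊢
      have := not_outside_ball_of_nearly_parallel (w₁ := c a - p a) (w₂ := c b - p b)
        hm hml hρ (by rw [hσ', ← h1]; ring) hdir hs hj hia hib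
        (h2.trans_eq (by rw [← mul_sub, hσ']; ring))
      rwa [hσ'] at this
    fin_cases j
    · exact main 1 2 (by decide) (by decide) fun g => Fin.sum_univ_three g
    · exact main 0 2 (by decide) (by decide) fun g => by rw [Fin.sum_univ_three]; simp; ring
    · exact main 0 1 (by decide) (by decide) fun g => by rw [Fin.sum_univ_three]; simp; ring
  have inj : Set.InjOn f T := by
    intro p hp q hq hpq
    by_contra hne
    have hi : ∀ i, |q i - p i| ≤ w i := fun i => by
      have := Int.abs_sub_le_of_floor_div_eq (hw i) (congrFun hpq i)
      rwa [sub_sub_sub_cancel_right, abs_sub_comm] at this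
    -- Of two points in one box, the one further back in direction `σ` has the other ahead of it, on
    -- the side of its own empty ball.
    rcases le_total 0 (σ * (q j - p j)) with h | h
    · exact absurd (close p hp q hq h hi) (sep p hp q hq hne).not_gt
    · refine absurd (close q hq p hp (by linarith) fun i => ?_) (sep q hq p hp (Ne.symm hne)).not_gt
      rw [abs_sub_comm]
      exact hi i
  have hcard : (T.card : ℝ) ≤ ∏ i, 3 * (L / w i) := by
    calc (T.card : ℝ) ≤ B.card := by exact_mod_cast Finset.card_le_card_of_injOn f maps inj
      _ = ∏ i, ((Finset.Icc ⌊-(L / w i)⌋ ⌊L / w i⌋).card : ℝ) := by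
          rw [Fintype.card_piFinset]; push_cast; rfl
      _ ≤ _ := Finset.prod_le_prod (fun _ _ => Nat.cast_nonneg _)
          fun i _ => Int.card_Icc_floor_le (hwL i)
  refine hcard.trans_eq ?_
  rw [Fin.prod_univ_three]
  simp only [w]
  fin_cases j <;> simp <;> field_simp <;> norm_num

/-- A separated point set in a ball of radius `L`, each point of which lies on an empty ball of
diameter at least `l`, has `O(L³ / l)` points. -/
lemma card_le_of_empty_balls (T : Finset E3) (x : E3) {m l L : ℝ} (hm : 0 < m) (hml : m ≤ l)
    (hlL : l ≤ L) (sep : ∀ p ∈ T, ∀ q ∈ T, p ≠ q → m ≤ dist p q) (hx : ∀ p ∈ T, dist p x ≤ L)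
    (hE : ∀ p ∈ T, ∃ c : E3, ∃ ρ : ℝ, l / 2 ≤ ρ ∧ dist p c = ρ ∧ ∀ q ∈ T, ρ ≤ dist q c) :
    (T.card : ℝ) ≤ 165888 * (L / m) ^ 2 * (L / l) := by
  classical
  let P : Fin 3 × ℤˣ → E3 → Prop := fun a p => ∃ c : E3, ∃ ρ : ℝ, l / 2 ≤ ρ ∧ dist p c = ρ ∧
    (∀ q ∈ T, ρ ≤ dist q c) ∧ ρ / 2 ≤ ((a.2 : ℤ) : ℝ) * (c a.1 - p a.1)
  have hP : ∀ p ∈ T, ∃ a, P a p := by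
    intro p hp
    obtain ⟨c, ρ, hρ, hpc, hemp⟩ := hE p hp
    have hρ0 : 0 < ρ := by linarith
    have h1 : ∑ i, (p i - c i) ^ 2 = ρ ^ 2 := by rw [← EuclideanSpace.dist_sq_eq_sum, hpc]
    -- Otherwise the three squares would sum to at most `3ρ²/4`.
    obtain ⟨j, hj⟩ : ∃ j, ρ / 2 ≤ |c j - p j| := by
      by_contra! hcon
      have : ∀ i, (p i - c i) ^ 2 ≤ (ρ / 2) ^ 2 := fun i => by
        rw [← sq_abs, abs_sub_comm]
        have := (hcon i).le
        gcongr
      rw [Fin.sum_univ_three] at h1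
      nlinarith [this 0, this 1, this 2]
    rcases le_abs.1 hj with h | h
    · exact ⟨(j, 1), c, ρ, hρ, hpc, hemp, by simpa using h⟩
    · exact ⟨(j, -1), c, ρ, hρ, hpc, hemp, by simpa using h⟩
  have hsub : T ⊆ Finset.univ.biUnion fun a => T.filter (P a) := by
    intro p hp
    obtain ⟨a, ha⟩ := hP p hp
    simp only [Finset.mem_biUnion, Finset.mem_univ, Finset.mem_filter, true_and]
    exact ⟨a, hp, ha⟩
  have hcls : ∀ a, ((T.filter (P a)).card : ℝ) ≤ 27648 * (L / m) ^ 2 * (L / l) := by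
    intro a
    refine card_le_of_empty_balls_in_direction _ x (σ := ((a.2 : ℤ) : ℝ)) a.1 ?_ hm hml hlL
      (fun p hp q hq => sep p (Finset.mem_filter.1 hp).1 q (Finset.mem_filter.1 hq).1)
      (fun p hp => hx p (Finset.mem_filter.1 hp).1) fun p hp => ?_
    · rcases Int.units_eq_one_or a.2 with h | h <;> simp [h]
    · obtain ⟨c, ρ, hρ, hpc, hemp, hdir⟩ := (Finset.mem_filter.1 hp).2
      exact ⟨c, ρ, hρ, hpc, fun q hq => hemp q (Finset.mem_filter.1 hq).1, hdir⟩
  calc (T.card : ℝ) ≤ ∑ a, ((T.filter (P a)).card : ℝ) := by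
        exact_mod_cast (Finset.card_le_card hsub).trans Finset.card_biUnion_le
    _ ≤ ∑ _a : Fin 3 × ℤˣ, 27648 * (L / m) ^ 2 * (L / l) :=
        Finset.sum_le_sum fun a _ => hcls a
    _ = _ := by
        rw [Finset.sum_const, Finset.card_univ, Fintype.card_prod, Fintype.card_fin,
          show Fintype.card ℤˣ = 2 from rfl]
        norm_num
        ring

/-! ### Counting Delaunay edges and vertices -/

/-- Ordered pairs of points of `S` on a common empty sphere. -/
def IsDelaunayPair (S : Finset E3) (e : E3 × E3) : Prop :=
  e.1 ≠ e.2 ∧ e.1 ∈ S ∧ e.2 ∈ S ∧ OnEmptySphere S {e.1, e.2}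

-- The packing bound is applied twice: at scale `D` to the possible first endpoints `T`, and at
-- scale `2 * l` to the candidates `N p` for the second.
open Classical in
lemma card_filter_isDelaunayPair_le_of_length (S : Finset E3) {m l D : ℝ} (hm : 0 < m)
    (hml : m ≤ l) (hlD : l ≤ D) (sep : ∀ p ∈ S, ∀ q ∈ S, p ≠ q → m ≤ dist p q)
    (hD : ∀ p ∈ S, ∀ q ∈ S, dist p q ≤ D) :
    (((S ×ˢ S).filter fun e => IsDelaunayPair S e ∧ l ≤ dist e.1 e.2 ∧
      dist e.1 e.2 ≤ 2 * l).card : ℝ) ≤ 8 * 165888 ^ 2 * (D ^ 3 * l / m ^ 4) := by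
  have hl : 0 < l := hm.trans_le hml
  have hDpos : 0 < D := hl.trans_le hlD
  let T := S.filter fun p => ∃ c : E3, ∃ ρ : ℝ, l / 2 ≤ ρ ∧ dist p c = ρ ∧ ∀ q ∈ S, ρ ≤ dist q c
  let N : E3 → Finset E3 := fun p => T.filter fun q => dist q p ≤ 2 * l
  have hTS : ∀ p ∈ T, p ∈ S := fun p hp => (Finset.mem_filter.1 hp).1
  have hTE : ∀ p ∈ T, ∃ c : E3, ∃ ρ : ℝ, l / 2 ≤ ρ ∧ dist p c = ρ ∧ ∀ q ∈ T, ρ ≤ dist q c := by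
    intro p hp
    obtain ⟨c, ρ, h1, h2, h3⟩ := (Finset.mem_filter.1 hp).2
    exact ⟨c, ρ, h1, h2, fun q hq => h3 q (hTS q hq)⟩
  have hNT : ∀ p, ∀ q ∈ N p, q ∈ T := fun p q hq => (Finset.mem_filter.1 hq).1
  have hT : (T.card : ℝ) ≤ 165888 * (D / m) ^ 2 * (D / l) := by
    rcases T.eq_empty_or_nonempty with h | ⟨x, hxT⟩
    · rw [h, Finset.card_empty, Nat.cast_zero]; positivity
    · exact card_le_of_empty_balls T x hm hml hlD
        (fun p hp q hq => sep p (hTS p hp) q (hTS q hq))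
        (fun p hp => hD p (hTS p hp) x (hTS x hxT)) hTE
  have hN : ∀ p, ((N p).card : ℝ) ≤ 165888 * (2 * l / m) ^ 2 * (2 * l / l) := by
    intro p
    refine card_le_of_empty_balls (N p) p hm hml (by linarith)
      (fun a ha b hb => sep a (hTS a (hNT p a ha)) b (hTS b (hNT p b hb)))
      (fun q hq => (Finset.mem_filter.1 hq).2) fun a ha => ?_
    obtain ⟨c, ρ, h1, h2, h3⟩ := hTE a (hNT p a ha)
    exact ⟨c, ρ, h1, h2, fun q hq => h3 q (hNT p q hq)⟩
  let F := (S ×ˢ S).filter fun e => IsDelaunayPair S e ∧ l ≤ dist e.1 e.2 ∧ dist e.1 e.2 ≤ 2 * l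
  have hF : F.card ≤ (T.sigma N).card := by
    refine Finset.card_le_card_of_injOn (fun e => ⟨e.1, e.2⟩) ?_ ?_
    · rintro ⟨p, q⟩ he
      obtain ⟨-, ⟨-, hp, hq, c, ρ, hc, hemp⟩, h1, h2⟩ := Finset.mem_filter.1 he
      have hpc : dist p c = ρ := hc p (by simp)
      have hqc : dist q c = ρ := hc q (by simp)
      have hρ : l / 2 ≤ ρ := by
        have := dist_triangle_right p q c
        dsimp only at h1
        linarith
      rw [Finset.mem_coe, Finset.mem_sigma]
      refine ⟨Finset.mem_filter.2 ⟨hp, c, ρ, hρ, hpc, hemp⟩, Finset.mem_filter.2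
        ⟨Finset.mem_filter.2 ⟨hq, c, ρ, hρ, hqc, hemp⟩, ?_⟩⟩
      rw [dist_comm]
      exact h2
    · rintro ⟨p, q⟩ - ⟨p', q'⟩ - h
      simpa using h
  calc (F.card : ℝ) ≤ ∑ p ∈ T, ((N p).card : ℝ) := by
        rw [Finset.card_sigma] at hF
        exact_mod_cast hF
    _ ≤ ∑ _p ∈ T, 165888 * (2 * l / m) ^ 2 * (2 * l / l) := Finset.sum_le_sum fun p _ => hN p
    _ = T.card * (165888 * (2 * l / m) ^ 2 * (2 * l / l)) := by
        rw [Finset.sum_const, nsmul_eq_mul]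
    _ ≤ 165888 * (D / m) ^ 2 * (D / l) * (165888 * (2 * l / m) ^ 2 * (2 * l / l)) := by gcongr
    _ = _ := by field_simp; norm_num

-- Lengths are grouped dyadically. The bound for one group grows linearly in its length, so the
-- geometric sum is dominated by the top scale, which is at most `D`.
open Classical in
lemma card_filter_isDelaunayPair_le (S : Finset E3) {m D : ℝ} (hm : 0 < m) (hmD : m ≤ D)
    (sep : ∀ p ∈ S, ∀ q ∈ S, p ≠ q → m ≤ dist p q) (hD : ∀ p ∈ S, ∀ q ∈ S, dist p q ≤ D) :
    (((S ×ˢ S).filter (IsDelaunayPair S)).card : ℝ) ≤ 16 * 165888 ^ 2 * (D / m) ^ 4 := by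
  have hDpos : 0 < D := hm.trans_le hmD
  obtain ⟨n, hn, hn'⟩ := exists_nat_pow_near ((one_le_div hm).2 hmD) one_lt_two
  rw [le_div_iff₀ hm] at hn
  rw [div_lt_iff₀ hm] at hn'
  let F : ℕ → Finset (E3 × E3) := fun i => (S ×ˢ S).filter fun e => IsDelaunayPair S e ∧
    2 ^ i * m ≤ dist e.1 e.2 ∧ dist e.1 e.2 ≤ 2 * (2 ^ i * m)
  have hsub : (S ×ˢ S).filter (IsDelaunayPair S) ⊆ (Finset.range (n + 1)).biUnion F := by
    intro e he
    obtain ⟨heS, hne, hp, hq, hemp⟩ := Finset.mem_filter.1 he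
    obtain ⟨i, hi, hi'⟩ := exists_nat_pow_near
      ((one_le_div hm).2 (sep _ hp _ hq hne)) (one_lt_two (α := ℝ))
    rw [le_div_iff₀ hm] at hi
    rw [div_lt_iff₀ hm] at hi'
    have hin : i < n + 1 := by
      have := (hi.trans (hD _ hp _ hq)).trans_lt hn'
      exact (pow_lt_pow_iff_right₀ (one_lt_two (α := ℝ))).1 (lt_of_mul_lt_mul_right this hm.le)
    refine Finset.mem_biUnion.2 ⟨i, Finset.mem_range.2 hin, Finset.mem_filter.2
      ⟨heS, ⟨hne, hp, hq, hemp⟩, hi, ?_⟩⟩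
    rw [pow_succ] at hi'
    linarith
  have hF : ∀ i ∈ Finset.range (n + 1),
      ((F i).card : ℝ) ≤ 8 * 165888 ^ 2 * (D ^ 3 * (2 ^ i * m) / m ^ 4) := by
    intro i hi
    refine card_filter_isDelaunayPair_le_of_length S hm ?_ ?_ sep hD
    · exact le_mul_of_one_le_left hm.le (one_le_pow₀ one_le_two)
    · refine le_trans ?_ hn
      have := Finset.mem_range_succ_iff.1 hi
      gcongr
      exact one_le_two
  have hgeom : ∑ i ∈ Finset.range (n + 1), (2 : ℝ) ^ i ≤ 2 * 2 ^ n := by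
    rw [geom_sum_eq (by norm_num), pow_succ]
    linarith
  calc (((S ×ˢ S).filter (IsDelaunayPair S)).card : ℝ)
      ≤ ∑ i ∈ Finset.range (n + 1), ((F i).card : ℝ) := by
        exact_mod_cast (Finset.card_le_card hsub).trans Finset.card_biUnion_le
    _ ≤ ∑ i ∈ Finset.range (n + 1), 8 * 165888 ^ 2 * (D ^ 3 * (2 ^ i * m) / m ^ 4) :=
        Finset.sum_le_sum hF
    _ = 8 * 165888 ^ 2 * (D ^ 3 * ((∑ i ∈ Finset.range (n + 1), 2 ^ i) * m) / m ^ 4) := by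
        rw [Finset.sum_mul, Finset.mul_sum, Finset.sum_div, Finset.mul_sum]
    _ ≤ 8 * 165888 ^ 2 * (D ^ 3 * ((2 * 2 ^ n) * m) / m ^ 4) := by gcongr
    _ = 8 * 165888 ^ 2 * (D ^ 3 * (2 * (2 ^ n * m)) / m ^ 4) := by ring
    _ ≤ 8 * 165888 ^ 2 * (D ^ 3 * (2 * D) / m ^ 4) := by gcongr
    _ = _ := by field_simp; norm_num

lemma card_le_of_separated (S : Finset E3) {m D : ℝ} (hm : 0 < m) (hmD : m ≤ D)
    (sep : ∀ p ∈ S, ∀ q ∈ S, p ≠ q → m ≤ dist p q) (hD : ∀ p ∈ S, ∀ q ∈ S, dist p q ≤ D) :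
    (S.card : ℝ) ≤ 165888 * (D / m) ^ 4 := by
  rcases S.eq_empty_or_nonempty with rfl | ⟨x, hx⟩
  · rw [Finset.card_empty, Nat.cast_zero]; positivity
  refine (card_le_of_empty_balls S x hm le_rfl hmD sep (fun p hp => hD p hp x hx)
    fun p hp => ?_).trans ?_
  -- By separation, any ball of radius `m / 2` through a point of `S` is empty, so the packing bound
  -- applies with `l = m`.
  · obtain ⟨v, hv⟩ := exists_norm_eq E3 (half_pos hm).le
    have hu : dist p (p + v) = m / 2 := by rw [dist_self_add_right, hv]
    refine ⟨p + v, m / 2, le_rfl, hu, fun q hq => ?_⟩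
    rcases eq_or_ne p q with rfl | hne
    · exact hu.ge
    · have := dist_triangle_right p q (p + v)
      linarith [sep p hp q hq hne]
  · have h1 : 1 ≤ D / m := (one_le_div hm).2 hmD
    rw [mul_assoc, ← pow_succ]
    exact mul_le_mul_of_nonneg_left (pow_le_pow_right₀ h1 (by norm_num)) (by norm_num)

/-! ### Faces of a simplicial complex determined by directions -/

-- Add `ε * c` to the uniform weights on `A`: for small `ε` the weights on `A` stay positive, and
-- off `A` they are positive because `c` is. The sum stays `1` since `c` sums to zero.
open Filter Topology in
lemma exists_pos_weights_of_direction {E : Type*} [AddCommGroup E] [Module ℝ E] {F A : Finset E}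
    {c : E → ℝ} (hc : ∑ v ∈ F, c v = 0) (hA : F.filter (fun v => c v ≤ 0) = A)
    (hne : A.Nonempty) :
    ∀ᶠ ε : ℝ in 𝓝[>] 0, ∃ w : E → ℝ, (∀ v ∈ F, 0 < w v) ∧ ∑ v ∈ F, w v = 1 ∧
      ∑ v ∈ F, w v • v = ∑ v ∈ A, (A.card : ℝ)⁻¹ • v + ε • ∑ v ∈ F, c v • v := by
  classical
  have hAF : F ∩ A = A := by
    rw [← hA]; exact Finset.inter_eq_right.2 (Finset.filter_subset _ _)
  have hcard : (0 : ℝ) < (A.card : ℝ)⁻¹ := by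
    have := hne.card_pos
    positivity
  have hsmall : ∀ᶠ ε : ℝ in 𝓝[>] 0, ∀ v ∈ F, 0 < (A.card : ℝ)⁻¹ + ε * c v := by
    rw [Filter.eventually_all_finset]
    intro v _
    have : Tendsto (fun ε : ℝ => (A.card : ℝ)⁻¹ + ε * c v) (𝓝 0) (𝓝 ((A.card : ℝ)⁻¹ + 0 * c v)) :=
      Continuous.tendsto (by fun_prop) 0
    rw [zero_mul, add_zero] at this
    exact nhdsWithin_le_nhds (this.eventually_const_lt hcard)
  filter_upwards [hsmall, self_mem_nhdsWithin] with ε hε hε0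
  refine ⟨fun v => (if v ∈ A then (A.card : ℝ)⁻¹ else 0) + ε * c v, fun v hv => ?_, ?_, ?_⟩
  · dsimp only
    split_ifs with h
    · exact hε v hv
    · have : 0 < c v := by
        by_contra! hcon
        exact h (hA ▸ Finset.mem_filter.2 ⟨hv, hcon⟩)
      rw [zero_add]
      exact mul_pos hε0 this
  · rw [Finset.sum_add_distrib, ← Finset.mul_sum, hc, Finset.sum_ite_mem, hAF, Finset.sum_const,
      nsmul_eq_mul, mul_zero, add_zero, mul_inv_cancel₀ (inv_pos.1 hcard).ne']
  · simp only [add_smul, ite_smul, zero_smul, mul_smul]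
    rw [Finset.sum_add_distrib, ← Finset.smul_sum, Finset.sum_ite_mem, hAF]

namespace Geometry.SimplicialComplex

variable {E : Type*} [AddCommGroup E] [Module ℝ E]

/-- The point also lies in the hull of `F ∩ G`, and affine independence of `F` makes its barycentric
coordinates unique. As all of them are positive, no vertex of `F` is missing from `G`. -/
lemma subset_of_mem_convexHull (K : SimplicialComplex ℝ E) {F G : Finset E}
    (hF : F ∈ K.faces) (hG : G ∈ K.faces) {w : E → ℝ} (hw : ∀ v ∈ F, 0 < w v)
    (hsum : ∑ v ∈ F, w v = 1) (hx : ∑ v ∈ F, w v • v ∈ convexHull ℝ (G : Set E)) : F ⊆ G := by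
  classical
  have hxF : ∑ v ∈ F, w v • v ∈ convexHull ℝ (F : Set E) :=
    Finset.mem_convexHull'.2 ⟨w, fun v hv => (hw v hv).le, hsum, rfl⟩
  have hxFG := K.inter_subset_convexHull hF hG ⟨hxF, hx⟩
  rw [← Finset.coe_inter, Finset.mem_convexHull'] at hxFG
  obtain ⟨w', -, hsum', hx'⟩ := hxFG
  have h0 := affineIndependent_iff.1 (K.indep hF) Finset.univ
    (fun v => w v - if (v : E) ∈ G then w' v else 0)
    (by
      rw [Finset.sum_coe_sort F (fun v => w v - if v ∈ G then w' v else 0),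
        Finset.sum_sub_distrib, Finset.sum_ite_mem, hsum, hsum', sub_self])
    (by
      rw [Finset.sum_coe_sort F (fun v => (w v - if v ∈ G then w' v else 0) • v)]
      simp only [sub_smul, ite_smul, zero_smul]
      rw [Finset.sum_sub_distrib, Finset.sum_ite_mem, hx', sub_self])
  intro v hv
  by_contra hvG
  have := h0 ⟨v, hv⟩ (Finset.mem_univ _)
  simp only [hvG, if_false, sub_zero] at this
  exact (hw v hv).ne' this

/-- A face is determined by a direction in its span together with the set of vertices at which
the barycentric coordinates of this direction are nonpositive. -/
lemma eq_of_direction (K : SimplicialComplex ℝ E) {F G A : Finset E} {z : E}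
    (hF : F ∈ K.faces) (hG : G ∈ K.faces) {c d : E → ℝ} (hA : A.Nonempty)
    (hc : ∑ v ∈ F, c v = 0) (hcz : ∑ v ∈ F, c v • v = z) (hcA : F.filter (fun v => c v ≤ 0) = A)
    (hd : ∑ v ∈ G, d v = 0) (hdz : ∑ v ∈ G, d v • v = z) (hdA : G.filter (fun v => d v ≤ 0) = A) :
    F = G := by
  obtain ⟨ε, ⟨w, hw, hw1, hwx⟩, w', hw', hw1', hwx'⟩ :=
    ((exists_pos_weights_of_direction hc hcA hA).and
      (exists_pos_weights_of_direction hd hdA hA)).exists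
  have heq : ∑ v ∈ F, w v • v = ∑ v ∈ G, w' v • v := by rw [hwx, hwx', hcz, hdz]
  refine (K.subset_of_mem_convexHull hF hG hw hw1 ?_).antisymm
    (K.subset_of_mem_convexHull hG hF hw' hw1' ?_)
  · rw [heq]
    exact Finset.mem_convexHull'.2 ⟨w', fun v hv => (hw' v hv).le, hw1', rfl⟩
  · rw [← heq]
    exact Finset.mem_convexHull'.2 ⟨w, fun v hv => (hw v hv).le, hw1, rfl⟩

end Geometry.SimplicialComplex

lemma exists_coordinates_of_mem_vectorSpan {E : Type*} [AddCommGroup E] [Module ℝ E]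
    {F : Finset E} {z : E} (hz : z ∈ vectorSpan ℝ (F : Set E)) :
    ∃ c : E → ℝ, ∑ v ∈ F, c v = 0 ∧ ∑ v ∈ F, c v • v = z := by
  classical
  induction hz using Submodule.span_induction with
  | mem x hx =>
    obtain ⟨p, hp, q, hq, rfl⟩ := hx
    rw [Finset.mem_coe] at hp hq
    refine ⟨fun v => (if p = v then 1 else 0) - if q = v then 1 else 0, ?_, ?_⟩
    · rw [Finset.sum_sub_distrib, Finset.sum_ite_eq, Finset.sum_ite_eq, if_pos hp, if_pos hq,
        sub_self]
    · simp only [sub_smul, ite_smul, one_smul, zero_smul]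
      rw [Finset.sum_sub_distrib, Finset.sum_ite_eq, Finset.sum_ite_eq, if_pos hp, if_pos hq]
      rfl
  | zero => exact ⟨0, by simp, by simp⟩
  | add x y _ _ hx hy =>
    obtain ⟨c, hc, rfl⟩ := hx
    obtain ⟨d, hd, rfl⟩ := hy
    exact ⟨c + d, by simp [Finset.sum_add_distrib, hc, hd],
      by simp [add_smul, Finset.sum_add_distrib]⟩
  | smul a x _ hx =>
    obtain ⟨c, hc, rfl⟩ := hx
    exact ⟨a • c, by simp [← Finset.mul_sum, hc], by simp [mul_smul, Finset.smul_sum]⟩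

lemma sum_eq_sum_pos_add_sum_neg {α M : Type*} [AddCommMonoid M] {F : Finset α} {c : α → ℝ}
    {f : α → M} (hf : ∀ v, c v = 0 → f v = 0) :
    ∑ v ∈ F, f v = ∑ v ∈ F with 0 < c v, f v + ∑ v ∈ F with c v < 0, f v := by
  rw [Finset.sum_filter, Finset.sum_filter, ← Finset.sum_add_distrib]
  refine Finset.sum_congr rfl fun v _ => ?_
  rcases lt_trichotomy (c v) 0 with h | h | h
  · rw [if_neg h.not_gt, if_pos h, zero_add]
  · simp [h, hf v h]
  · rw [if_neg h.not_gt, if_pos h, add_zero]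

/-- If both sets had three elements, at most one coordinate would be positive and at most one
negative, and `z` would be zero or parallel to an edge of `F`. -/
lemma card_nonpos_or_nonneg_coordinates_le_two {E : Type*} [AddCommGroup E] [Module ℝ E]
    {F : Finset E} {z : E} {c : E → ℝ} (hF : F.card ≤ 4) (hc : ∑ v ∈ F, c v = 0)
    (hcz : ∑ v ∈ F, c v • v = z) (hz0 : z ≠ 0)
    (hz : ∀ p ∈ F, ∀ q ∈ F, z ∉ Submodule.span ℝ {p - q}) :
    (F.filter fun v => c v ≤ 0).card ≤ 2 ∨ (F.filter fun v => 0 ≤ c v).card ≤ 2 := by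
  by_contra! hcon
  have hP : (F.filter fun v => 0 < c v).card ≤ 1 := by
    have := F.card_filter_add_card_filter_not (fun v => c v ≤ 0)
    simp only [not_le] at this
    omega
  have hN : (F.filter fun v => c v < 0).card ≤ 1 := by
    have := F.card_filter_add_card_filter_not (fun v => 0 ≤ c v)
    simp only [not_le] at this
    omega
  have hsplit := sum_eq_sum_pos_add_sum_neg (F := F) (c := c) (f := fun v => c v • v)
    fun v h => by rw [h, zero_smul]
  have split0 := sum_eq_sum_pos_add_sum_neg (F := F) (f := c) (c := c) fun v h => h
  rw [hcz] at hsplit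
  rw [hc] at split0
  have hPc := Finset.card_eq_zero.or Finset.card_eq_one |>.1 (Nat.le_one_iff_eq_zero_or_eq_one.1 hP)
  have hNc := Finset.card_eq_zero.or Finset.card_eq_one |>.1 (Nat.le_one_iff_eq_zero_or_eq_one.1 hN)
  rcases hPc with hPe | ⟨p, hPe⟩ <;> rcases hNc with hNe | ⟨q, hNe⟩ <;>
    simp only [hPe, hNe, Finset.sum_empty, Finset.sum_singleton, zero_add, add_zero]
      at hsplit split0
  · exact hz0 hsplit
  · rw [← split0, zero_smul] at hsplit
    exact hz0 hsplit
  · rw [← split0, zero_smul] at hsplit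
    exact hz0 hsplit
  · have hp : p ∈ F := Finset.filter_subset _ F (hPe ▸ Finset.mem_singleton_self p)
    have hq : q ∈ F := Finset.filter_subset _ F (hNe ▸ Finset.mem_singleton_self q)
    refine hz p hp q hq (Submodule.mem_span_singleton.2 ⟨c p, ?_⟩)
    rw [hsplit, smul_sub, eq_neg_of_add_eq_zero_right split0.symm, neg_smul, sub_eq_add_neg]

/-- A finite point set spanning at least a plane spans a direction that is not parallel to any
line through two of its points. -/
lemma exists_mem_vectorSpan_notMem_span_sub {E : Type*} [AddCommGroup E] [Module ℝ E]
    [FiniteDimensional ℝ E] (S : Finset E) (hS : 2 ≤ Module.finrank ℝ (vectorSpan ℝ (S : Set E))) :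
    ∃ z ∈ vectorSpan ℝ (S : Set E), ∀ p ∈ S, ∀ q ∈ S, z ∉ Submodule.span ℝ {p - q} := by
  classical
  let V := vectorSpan ℝ (S : Set E)
  let 𝓛 : Finset (Subspace ℝ V) :=
    (S ×ˢ S).image fun e => (Submodule.span ℝ {e.1 - e.2}).comap V.subtype
  have htop : ⊤ ∉ 𝓛 := by
    intro h
    obtain ⟨e, -, he⟩ := Finset.mem_image.1 h
    have hle : V ≤ Submodule.span ℝ {e.1 - e.2} := by
      intro v hv
      have : (⟨v, hv⟩ : V) ∈ (Submodule.span ℝ {e.1 - e.2}).comap V.subtype := he ▸ trivial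
      exact this
    have := (Submodule.finrank_mono hle).trans (finrank_span_le_card _)
    simp only [Set.toFinset_singleton, Finset.card_singleton] at this
    exact absurd (hS.trans this) (by norm_num)
  -- A real vector space is not a finite union of proper subspaces.
  obtain ⟨z, hz⟩ := (Set.ne_univ_iff_exists_notMem _).1
    (Subspace.biUnion_ne_univ_of_top_notMem htop)
  refine ⟨z, z.2, fun p hp q hq hpq => hz ?_⟩
  exact Set.mem_biUnion (Finset.mem_image.2 ⟨(p, q), Finset.mk_mem_product hp hq, rfl⟩) hpq

open Filter Topology in
/-- A face whose affine span does not contain the convex underlying space is not maximal. -/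
lemma Geometry.SimplicialComplex.exists_ssubset_of_notMem_affineSpan {E : Type*}
    [NormedAddCommGroup E] [NormedSpace ℝ E] (K : Geometry.SimplicialComplex ℝ E)
    (hfin : K.faces.Finite) (hconv : Convex ℝ K.space) {F : Finset E} (hF : F ∈ K.faces) {s : E}
    (hs : s ∈ K.space) (hsF : s ∉ affineSpan ℝ (F : Set E)) : ∃ G ∈ K.faces, F ⊂ G := by
  have hFne := K.nonempty_of_mem_faces hF
  have hcard : (0 : ℝ) < (F.card : ℝ)⁻¹ := by
    have := hFne.card_pos
    positivity
  have hsum : ∑ _v ∈ F, (F.card : ℝ)⁻¹ = 1 := by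
    rw [Finset.sum_const, nsmul_eq_mul, mul_inv_cancel₀ (inv_pos.1 hcard).ne']
  obtain ⟨c, hc⟩ : ∃ c, ∑ v ∈ F, (F.card : ℝ)⁻¹ • v = c := ⟨_, rfl⟩
  have hcF : c ∈ convexHull ℝ (F : Set E) :=
    Finset.mem_convexHull'.2 ⟨fun _ => (F.card : ℝ)⁻¹, fun _ _ => hcard.le, hsum, hc⟩
  -- Moving slightly from the centroid `c` of `F` towards `s` meets only faces whose hull contains
  -- `c`, and these contain `F`.
  have haway : ∀ᶠ t : ℝ in 𝓝[>] 0, ∀ G ∈ K.faces, c ∉ convexHull ℝ (G : Set E) →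
      AffineMap.lineMap c s t ∉ convexHull ℝ (G : Set E) := by
    rw [eventually_all_finite hfin]
    intro G _
    by_cases hcG : c ∈ convexHull ℝ (G : Set E)
    · exact Eventually.of_forall fun t h => absurd hcG h
    · have hopen : IsOpen (convexHull ℝ (G : Set E))ᶜ :=
        (G.finite_toSet.isClosed_convexHull ℝ).isOpen_compl
      have hlim : Tendsto (fun t : ℝ => AffineMap.lineMap c s t) (𝓝 0) (𝓝 c) := by
        have : Continuous fun t : ℝ => AffineMap.lineMap c s t := AffineMap.lineMap_continuous
        simpa using this.tendsto 0
      filter_upwards [nhdsWithin_le_nhds (hlim.eventually (hopen.mem_nhds hcG))] with t ht _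
      exact ht
  obtain ⟨t, ht, ht0, ht1⟩ := (haway.and (Ioo_mem_nhdsGT (zero_lt_one (α := ℝ)))).exists
  have hmem : AffineMap.lineMap c s t ∈ K.space :=
    hconv.lineMap_mem (K.convexHull_subset_space hF hcF) hs ⟨ht0.le, ht1.le⟩
  obtain ⟨G, hG, htG⟩ := Geometry.SimplicialComplex.mem_space_iff.1 hmem
  have hcG : c ∈ convexHull ℝ (G : Set E) := by
    by_contra h
    exact ht G hG h htG
  refine ⟨G, hG, (K.subset_of_mem_convexHull hF hG (fun _ _ => hcard) hsum
    (hc ▸ hcG)).ssubset_of_ne ?_⟩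
  rintro rfl
  have h1 := convexHull_subset_affineSpan (𝕜 := ℝ) _ htG
  have h2 := convexHull_subset_affineSpan (𝕜 := ℝ) _ hcF
  refine hsF ?_
  have := AffineMap.lineMap_mem t⁻¹ h2 h1
  rwa [AffineMap.lineMap_lineMap_right, inv_mul_cancel₀ ht0.ne', AffineMap.lineMap_apply_one]
    at this

/-! ### Complexity of a Delaunay triangulation -/

namespace IsDelaunayTriangulation

variable {S : Finset E3} {K : Geometry.SimplicialComplex ℝ E3}

lemma subset (h : IsDelaunayTriangulation S K) {F : Finset E3} (hF : F ∈ K.faces) : F ⊆ S := by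
  intro v hv
  have : v ∈ K.vertices := Geometry.SimplicialComplex.mem_vertices.2
    (K.down_closed hF (Finset.singleton_subset_iff.2 hv) (Finset.singleton_nonempty v))
  rwa [h.vertices_eq] at this

lemma finite_faces (h : IsDelaunayTriangulation S K) : K.faces.Finite :=
  S.powerset.finite_toSet.subset fun _ hF => Finset.mem_coe.2 (Finset.mem_powerset.2 (h.subset hF))

lemma card_le_four {F : Finset E3} (hF : F ∈ K.faces) : F.card ≤ 4 := by
  have h1 := (K.indep hF).card_le_finrank_succ
  have h2 := Submodule.finrank_le (vectorSpan ℝ (Set.range ((↑) : F → E3)))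
  rw [finrank_euclideanSpace_fin] at h2
  rw [Fintype.card_coe] at h1
  omega

lemma exists_spanning_face (h : IsDelaunayTriangulation S K) {F : Finset E3} (hF : F ∈ K.faces) :
    ∃ G ∈ K.faces, F ⊆ G ∧ (S : Set E3) ⊆ affineSpan ℝ (G : Set E3) := by
  obtain ⟨G, hFG, hG⟩ := h.finite_faces.exists_le_maximal hF
  refine ⟨G, hG.1, hFG, fun s hs => ?_⟩
  by_contra hcon
  obtain ⟨G', hG', hlt⟩ := K.exists_ssubset_of_notMem_affineSpan h.finite_faces
    (h.space_eq ▸ convex_convexHull ℝ _) hG.1 (h.space_eq ▸ subset_convexHull ℝ _ hs) hcon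
  exact hlt.2 (hG.2 hG' hlt.1)

lemma vectorSpan_le_of_spanning {F : Finset E3}
    (hFS : (S : Set E3) ⊆ affineSpan ℝ (F : Set E3)) :
    vectorSpan ℝ (S : Set E3) ≤ vectorSpan ℝ (F : Set E3) := by
  rw [← direction_affineSpan, ← direction_affineSpan]
  exact AffineSubspace.direction_le (affineSpan_le.2 hFS)

open Classical in
lemma card_spanning_faces_le (h : IsDelaunayTriangulation S K) :
    (h.finite_faces.toFinset.filter fun F : Finset E3 =>
      (S : Set E3) ⊆ affineSpan ℝ (F : Set E3) ∧ 3 ≤ F.card).card ≤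
    2 * (h.finite_faces.toFinset.filter fun F : Finset E3 => F.card ≤ 2).card := by
  rcases Finset.eq_empty_or_nonempty (h.finite_faces.toFinset.filter fun F : Finset E3 =>
      (S : Set E3) ⊆ affineSpan ℝ (F : Set E3) ∧ 3 ≤ F.card) with he | ⟨F₀, hF₀⟩
  · rw [he, Finset.card_empty]; exact Nat.zero_le _
  simp only [Finset.mem_filter, Set.Finite.mem_toFinset] at hF₀
  have hrank : 2 ≤ Module.finrank ℝ (vectorSpan ℝ (S : Set E3)) := by
    have h1 := (K.indep hF₀.1).card_le_finrank_succ
    rw [Fintype.card_coe, Subtype.range_coe_subtype, Finset.setOfPred_mem] at h1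
    have h2 := Submodule.finrank_mono
      (vectorSpan_mono ℝ (Finset.coe_subset.2 (h.subset hF₀.1)))
    have h3 := hF₀.2.2
    omega
  obtain ⟨z, hz, hzpar⟩ := exists_mem_vectorSpan_notMem_span_sub S hrank
  have hz0 : z ≠ 0 := by
    rintro rfl
    obtain ⟨v, hv⟩ := K.nonempty_of_mem_faces hF₀.1
    exact hzpar v (h.subset hF₀.1 hv) v (h.subset hF₀.1 hv) (Submodule.zero_mem _)
  -- Each spanning face is charged to a pair of a small face and a sign of `z`; `eq_of_direction`
  -- shows that no pair is charged twice.
  let R : Finset E3 → Finset E3 × E3 → Prop := fun F a => ∃ c : E3 → ℝ, ∑ v ∈ F, c v = 0 ∧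
    ∑ v ∈ F, c v • v = a.2 ∧ F.filter (fun v => c v ≤ 0) = a.1
  refine (Finset.card_le_card_of_forall_subsingleton R (t :=
    (h.finite_faces.toFinset.filter fun F : Finset E3 => F.card ≤ 2) ×ˢ {z, -z}) ?_ ?_).trans ?_
  · intro F hF
    simp only [Finset.mem_filter, Set.Finite.mem_toFinset] at hF
    obtain ⟨hFK, hFS, hF3⟩ := hF
    have hsmall : ∀ (c : E3 → ℝ), ∑ v ∈ F, c v = 0 → (F.filter fun v => c v ≤ 0).card ≤ 2 →
        F.filter (fun v => c v ≤ 0) ∈ h.finite_faces.toFinset.filter fun F : Finset E3 => F.card ≤ 2 := by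
      intro c hc hcard
      refine Finset.mem_filter.2 ⟨h.finite_faces.mem_toFinset.2
        (K.down_closed hFK (Finset.filter_subset _ _) ?_), hcard⟩
      by_contra hcon
      rw [Finset.not_nonempty_iff_eq_empty, Finset.filter_eq_empty_iff] at hcon
      exact (Finset.sum_pos (fun v hv => not_le.1 (hcon hv)) (K.nonempty_of_mem_faces hFK)).ne' hc
    obtain ⟨c, hc, hcz⟩ := exists_coordinates_of_mem_vectorSpan (vectorSpan_le_of_spanning hFS hz)
    rcases card_nonpos_or_nonneg_coordinates_le_two (card_le_four hFK) hc hcz hz0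
      (fun p hp q hq => hzpar p (h.subset hFK hp) q (h.subset hFK hq)) with hcard | hcard
    · exact ⟨(_, z), Finset.mk_mem_product (hsmall c hc hcard) (by simp), c, hc, hcz, rfl⟩
    · have hc' : ∑ v ∈ F, (-c) v = 0 := by simp [hc]
      refine ⟨(_, -z), Finset.mk_mem_product (hsmall (-c) hc' ?_) (by simp), -c, hc', ?_, rfl⟩
      · simpa using hcard
      · simp [← hcz]
  · rintro ⟨A, y⟩ hA F ⟨hF, c, hc, hcz, hcA⟩ G ⟨hG, d, hd, hdz, hdA⟩
    simp only [Finset.mem_filter, Finset.mem_product, Set.Finite.mem_toFinset] at hF hG hA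
    exact K.eq_of_direction hF.1 hG.1 (K.nonempty_of_mem_faces hA.1.1) hc hcz hcA hd hdz hdA
  · rw [Finset.card_product, mul_comm]
    exact Nat.mul_le_mul_right _ Finset.card_le_two

-- The factor is `48 = 3 * 16`: spanning faces number at most three times the faces with at most two
-- vertices, and each has at most `2 ^ 4` subsets.
open Classical in
lemma complexity_le (h : IsDelaunayTriangulation S K) :
    complexity K ≤ 48 * (h.finite_faces.toFinset.filter fun F : Finset E3 => F.card ≤ 2).card := by
  let 𝓜 := h.finite_faces.toFinset.filter fun F : Finset E3 => (S : Set E3) ⊆ affineSpan ℝ (F : Set E3)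
  have hsub : h.finite_faces.toFinset ⊆ 𝓜.biUnion Finset.powerset := by
    intro F hF
    obtain ⟨G, hG, hFG, hGS⟩ := h.exists_spanning_face (h.finite_faces.mem_toFinset.1 hF)
    exact Finset.mem_biUnion.2 ⟨G, Finset.mem_filter.2 ⟨h.finite_faces.mem_toFinset.2 hG, hGS⟩,
      Finset.mem_powerset.2 hFG⟩
  have hM : 𝓜.card ≤ 3 * (h.finite_faces.toFinset.filter fun F : Finset E3 => F.card ≤ 2).card := by
    have hsplit : 𝓜 ⊆ (h.finite_faces.toFinset.filter fun F : Finset E3 => F.card ≤ 2) ∪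
        (h.finite_faces.toFinset.filter fun F : Finset E3 =>
          (S : Set E3) ⊆ affineSpan ℝ (F : Set E3) ∧ 3 ≤ F.card) := by
      intro F hF
      have hF' := Finset.mem_filter.1 hF
      rcases Nat.lt_or_ge 2 F.card with h2 | h2
      · exact Finset.mem_union_right _ (Finset.mem_filter.2 ⟨hF'.1, hF'.2, h2⟩)
      · exact Finset.mem_union_left _ (Finset.mem_filter.2 ⟨hF'.1, h2⟩)
    have := (Finset.card_le_card hsplit).trans (Finset.card_union_le _ _)
    have := h.card_spanning_faces_le
    omega
  have hpow : (𝓜.biUnion Finset.powerset).card ≤ 𝓜.card * 16 := by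
    refine Finset.card_biUnion_le_card_mul _ _ _ fun F hF => ?_
    rw [Finset.card_powerset]
    exact Nat.pow_le_pow_right (n := 2) two_pos
      (card_le_four (h.finite_faces.mem_toFinset.1 (Finset.mem_filter.1 hF).1))
  have hle := (Finset.card_le_card hsub).trans hpow
  rw [complexity, Set.ncard_eq_toFinset_card _ h.finite_faces]
  omega

open Classical in
lemma card_faces_le_two_le (h : IsDelaunayTriangulation S K) :
    (h.finite_faces.toFinset.filter fun F : Finset E3 => F.card ≤ 2).card ≤
      S.card + ((S ×ˢ S).filter (IsDelaunayPair S)).card := by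
  have hsub : (h.finite_faces.toFinset.filter fun F : Finset E3 => F.card ≤ 2) ⊆
      S.image (fun p => {p}) ∪
        ((S ×ˢ S).filter (IsDelaunayPair S)).image fun e => {e.1, e.2} := by
    intro F hF
    obtain ⟨hFK, hF2⟩ := Finset.mem_filter.1 hF
    rw [h.finite_faces.mem_toFinset] at hFK
    have hpos := (K.nonempty_of_mem_faces hFK).card_pos
    obtain h1 | h2 : F.card = 1 ∨ F.card = 2 := by omega
    · obtain ⟨p, rfl⟩ := Finset.card_eq_one.1 h1
      exact Finset.mem_union_left _ (Finset.mem_image.2 ⟨p, h.subset hFK (by simp), rfl⟩)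
    · obtain ⟨p, q, hpq, rfl⟩ := Finset.card_eq_two.1 h2
      have hp : p ∈ S := h.subset hFK (by simp)
      have hq : q ∈ S := h.subset hFK (by simp)
      refine Finset.mem_union_right _ (Finset.mem_image.2 ⟨(p, q), Finset.mem_filter.2
        ⟨Finset.mk_mem_product hp hq, hpq, hp, hq, ?_⟩, rfl⟩)
      simpa using h.empty_sphere _ hFK
  exact (Finset.card_le_card hsub).trans ((Finset.card_union_le _ _).trans
    (Nat.add_le_add Finset.card_image_le Finset.card_image_le))

end IsDelaunayTriangulation

/-! ### Conclusion -/

open Classical in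
lemma ncard_edgeSet_delaunayGraph_le (S : Finset E3) :
    (delaunayGraph S).edgeSet.ncard ≤ ((S ×ˢ S).filter (IsDelaunayPair S)).card := by
  have hsub : (delaunayGraph S).edgeSet ⊆
      (((S ×ˢ S).filter (IsDelaunayPair S)).image fun e => s(e.1, e.2) : Finset (Sym2 E3)) := by
    intro e
    induction e with
    | _ p q =>
      intro he
      have he' : IsDelaunayPair S (p, q) := (SimpleGraph.mem_edgeSet _).1 he
      exact Finset.mem_coe.2 (Finset.mem_image.2 ⟨(p, q), Finset.mem_filter.2
        ⟨Finset.mk_mem_product he'.2.1 he'.2.2.1, he'⟩, rfl⟩)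
  refine (Set.ncard_le_ncard hsub (Finset.finite_toSet _)).trans ?_
  rw [Set.ncard_coe_finset]
  exact Finset.card_image_le

theorem mainTheorem3 :
    ∃ C : ℝ, ∀ S : Finset E3, 2 ≤ S.card →
      ((delaunayGraph S).edgeSet.ncard : ℝ) ≤ C * spread S ^ 4 ∧
      ∀ K : Geometry.SimplicialComplex ℝ E3, IsDelaunayTriangulation S K →
        (complexity K : ℝ) ≤ C * spread S ^ 4 := by
  classical
  refine ⟨48 * (165888 + 16 * 165888 ^ 2), fun S hS => ?_⟩
  have hnt : (S : Set E3).Nontrivial := Finset.one_lt_card_iff_nontrivial.1 hS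
  have hm : 0 < Set.infsep (S : Set E3) := S.finite_toSet.infsep_pos_iff_nontrivial.2 hnt
  have sep : ∀ p ∈ S, ∀ q ∈ S, p ≠ q → Set.infsep (S : Set E3) ≤ dist p q :=
    fun p hp q hq hpq => Set.infsep_le_dist_of_mem hp hq hpq
  have hD : ∀ p ∈ S, ∀ q ∈ S, dist p q ≤ Metric.diam (S : Set E3) :=
    fun p hp q hq => Metric.dist_le_diam_of_mem S.finite_toSet.isBounded hp hq
  have hmD : Set.infsep (S : Set E3) ≤ Metric.diam (S : Set E3) := by
    obtain ⟨p, hp, q, hq, hpq⟩ := hnt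
    exact (sep p hp q hq hpq).trans (hD p hp q hq)
  have hV : (S.card : ℝ) ≤ 165888 * spread S ^ 4 := card_le_of_separated S hm hmD sep hD
  have hE : (((S ×ˢ S).filter (IsDelaunayPair S)).card : ℝ) ≤ 16 * 165888 ^ 2 * spread S ^ 4 :=
    card_filter_isDelaunayPair_le S hm hmD sep hD
  have hpos : 0 ≤ spread S ^ 4 := by positivity
  constructor
  · have : ((delaunayGraph S).edgeSet.ncard : ℝ) ≤ ((S ×ˢ S).filter (IsDelaunayPair S)).card := by
      exact_mod_cast ncard_edgeSet_delaunayGraph_le S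
    nlinarith
  · intro K hK
    have : (complexity K : ℝ) ≤
        48 * (S.card + ((S ×ˢ S).filter (IsDelaunayPair S)).card) := by
      exact_mod_cast hK.complexity_le.trans (Nat.mul_le_mul_left 48 hK.card_faces_le_two_le)
    linarith
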